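/- Let $d\ge 1$, let $\Omega\subset\mathbb R^d$ be a bounded open set (in particular, a bounded Lipschitz domain) and let $T>0$. Let $(\cdot,\cdot)$ and $\|\cdot\|$ denote the inner product and the norm of $L^2(\Omega)$ (or of $L^2(\Omega)^d$). Assume the following. 1. $\rho\in C^1([0,T];L^\infty(\Omega))$ with $0<\rho_0\le\rho(t,x)\le\rho_1<\infty$ and $|\partial_t\rho(t,x)|\le\rho_1'<\infty$. 2. $\eta\in C([0,T];L^\infty(\Omega))$ with $0<\eta_0\le\eta(t,x)\le\eta_1<\infty$. 3. $\kappa\in C^1([0,T];L^\infty(\Omega))$ with $0<\kappa_0\le\kappa(t,x)\le\kappa_1<\infty$ and $|\partial_t\kappa(t,x)|\le\kappa_1'<\infty$. 4. $f:\mathbb R\to\mathbb R$ is Lipschitz continuous. 5. $\tilde u_0\in H^1_0(\Omega)$. 6. $\rho\in C([0,T];H^1(\Omega))$. 7. $\omega\in H^1_0(\Omega)$. 8. $p\in C([0,T];L^2(\Omega))$, and $\underline\omega(t):=\left(p(t),\frac{\omega}{\rho(t)}\right)\ne0$ for all $t\in[0,T]$. Put $\underline\omega_m:=\min_{t\in[0,T]}|\underline\omega(t)|>0$.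 9. $m\in H^1(0,T)$. 10. $\nabla\left(\frac{\omega}{\rho(t)}\right)\in L^2(\Omega)^d$ for every $t\in[0,T]$, with $M:=\sup_{t\in[0,T]}\left\|\nabla\left(\frac{\omega}{\rho(t)}\right)\right\|<\infty$, and there is a constant $\zeta\in(0,1)$ such that $$\|p\|_{C([0,T];L^2(\Omega))}^2\,\frac{M^2\eta_1^2}{4\,\underline\omega_m^2\,\eta_0\,\rho_0}<\zeta .$$ Then there is at most one couple $(u,h)$ with $h\in L^2(0,T)$, $u\in C([0,T];H^1_0(\Omega))$, $\partial_tu\in L^2(0,T;H^1_0(\Omega))$ and $u(0)=\tilde u_0$ such that for almost every $t\in(0,T)$ $$h(t)=\frac1{\underline\omega(t)}\Big[m'(t)+\Big(u(t),\tfrac{\omega\,\partial_t\rho(t)}{\rho(t)}\Big)+\Big(\eta(t)\nabla\partial_tu(t),\nabla\big(\tfrac{\omega}{\rho(t)}\big)\Big)+\Big(\kappa(t)\nabla u(t),\nabla\big(\tfrac{\omega}{\rho(t)}\big)\Big)-\Big(f(u(t)),\tfrac{\omega}{\rho(t)}\Big)\Big]$$ and $$(\partial_t(\rho(t)u(t)),\varphi)+(\eta(t)\nabla\partial_tu(t),\nabla\varphi)+(\kappa(t)\nabla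 u(t),\nabla\varphi)=h(t)\,(p(t),\varphi)+(f(u(t)),\varphi)\qquad\text{for all }\varphi\in H^1_0(\Omega).$$ That is, if $(u_1,h_1)$ and $(u_2,h_2)$ are two such couples, then $u_1(t)=u_2(t)$ for all $t\in[0,T]$ and $h_1=h_2$ almost everywhere in $(0,T)$. -/

import Mathlib

open MeasureTheory Set
open scoped ENNReal NNReal InnerProductSpace

noncomputable section

namespace PseudoParabolic

/-- The Euclidean space `ℝ^d`. -/
abbrev E (d : ℕ) : Type := EuclideanSpace ℝ (Fin d)

/-- The space `L^q(Ω; F)` with respect to Lebesgue measure. -/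
abbrev LSp {d : ℕ} (Ω : Set (E d)) (F : Type) [NormedAddCommGroup F] (q : ℝ≥0∞) : Type :=
  Lp F q ((volume : Measure (E d)).restrict Ω)

/-- The `L²(Ω)` inner product of two scalar or vector valued functions. -/
def ip {d : ℕ} (Ω : Set (E d)) {F : Type} [NormedAddCommGroup F] [InnerProductSpace ℝ F]
    (v w : E d → F) : ℝ :=
  ∫ x in Ω, ⟪v x, w x⟫_ℝ

/-- `φ ∈ C_c^∞(U)`. -/
def IsTestFunction {X : Type} [NormedAddCommGroup X] [NormedSpace ℝ X]
    (U : Set X) (φ : X → ℝ) : Prop :=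
  ContDiff ℝ ((⊤ : ℕ∞) : WithTop ℕ∞) φ ∧ HasCompactSupport φ ∧ tsupport φ ⊆ U

/-- `g` is the weak (distributional) gradient of `v` in `Ω`. -/
def IsWeakGradient {d : ℕ} (Ω : Set (E d)) (v : E d → ℝ) (g : E d → E d) : Prop :=
  LocallyIntegrableOn v Ω ∧ LocallyIntegrableOn g Ω ∧
    ∀ φ : E d → ℝ, IsTestFunction Ω φ →
      ∫ x in Ω, v x • gradient φ x = -∫ x in Ω, φ x • g x

/-- Pairs `(v, g)` with `v ∈ L²(Ω)`, `g ∈ L²(Ω)^d`, normed by `(‖v‖² + ‖g‖²)^{1/2}`.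
On pairs `(v, ∇v)` this is the norm of `H¹(Ω)`. -/
abbrev L2Pair {d : ℕ} (Ω : Set (E d)) : Type :=
  WithLp 2 (LSp Ω ℝ 2 × LSp Ω (E d) 2)

/-- The Sobolev space `H¹(Ω)`, its element `v` being represented by `(v, ∇v)`. -/
def H1 {d : ℕ} (Ω : Set (E d)) : Set (L2Pair Ω) :=
  {v | IsWeakGradient Ω v.fst v.snd}

/-- The Sobolev space `H¹₀(Ω)`: the closure in the `H¹`-norm of the pairs `(φ, ∇φ)` with
`φ ∈ C_c^∞(Ω)`. -/
def H10 {d : ℕ} (Ω : Set (E d)) : Submodule ℝ (L2Pair Ω) :=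
  (Submodule.span ℝ {v : L2Pair Ω | ∃ φ : E d → ℝ, IsTestFunction Ω φ ∧
    v.fst =ᵐ[volume.restrict Ω] φ ∧ v.snd =ᵐ[volume.restrict Ω] gradient φ}).topologicalClosure

/-- The element of `L²(Ω)` underlying an element of `H¹₀(Ω)`. -/
def val {d : ℕ} {Ω : Set (E d)} (v : H10 Ω) : LSp Ω ℝ 2 := (v : L2Pair Ω).fst

/-- The gradient of an element of `H¹₀(Ω)`. -/
def grad {d : ℕ} {Ω : Set (E d)} (v : H10 Ω) : LSp Ω (E d) 2 := (v : L2Pair Ω).snd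

/-- `dv` is the weak derivative of the Banach space valued function `v` on `(0,T)`. -/
def IsWeakTimeDeriv {X : Type} [NormedAddCommGroup X] [NormedSpace ℝ X]
    (T : ℝ) (v dv : ℝ → X) : Prop :=
  LocallyIntegrableOn v (Ioo 0 T) ∧ LocallyIntegrableOn dv (Ioo 0 T) ∧
    ∀ φ : ℝ → ℝ, IsTestFunction (Ioo 0 T) φ →
      ∫ t in Ioo 0 T, deriv φ t • v t = -∫ t in Ioo 0 T, φ t • dv t

/-- `v ∈ L²((0,T); X)`. -/
def MemL2Time {X : Type} [NormedAddCommGroup X] (T : ℝ) (v : ℝ → X) : Prop :=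
  MemLp v 2 (volume.restrict (Ioo 0 T))

/-- The time derivative of a `C¹` function on `[0,T]` (one-sided at the end points). -/
def timeDeriv {X : Type} [NormedAddCommGroup X] [NormedSpace ℝ X]
    (T : ℝ) (v : ℝ → X) (t : ℝ) : X :=
  derivWithin v (Icc 0 T) t

/-- The function `ω / ρ(t)`. -/
def quot {d : ℕ} {Ω : Set (E d)} (ω : H10 Ω) (ρ : ℝ → LSp Ω ℝ ∞) (t : ℝ) (x : E d) : ℝ :=
  val ω x / ρ t x

/-- The function `t ↦ (p(t), ω / ρ(t))`. -/
def omegaBar {d : ℕ} {Ω : Set (E d)} (p : ℝ → LSp Ω ℝ 2) (ω : H10 Ω)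
    (ρ : ℝ → LSp Ω ℝ ∞) (t : ℝ) : ℝ :=
  ip Ω (p t) (quot ω ρ t)

/-- The right-hand side of the formula for `h(t)`, in which `dm = m'`, `G(t) = ∇(ω/ρ(t))`,
`u = u(t)` and `du = ∂ₜu(t)`. -/
def sourceFormula {d : ℕ} {Ω : Set (E d)} (T : ℝ) (ρ η κ : ℝ → LSp Ω ℝ ∞) (f : ℝ → ℝ)
    (p : ℝ → LSp Ω ℝ 2) (ω : H10 Ω) (dm : ℝ → ℝ) (G : ℝ → LSp Ω (E d) 2)
    (t : ℝ) (u du : H10 Ω) : ℝ :=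
  1 / omegaBar p ω ρ t *
    (dm t
      + ip Ω (val u) (fun x => val ω x * timeDeriv T ρ t x / ρ t x)
      + ip Ω (fun x => η t x • grad du x) (G t)
      + ip Ω (fun x => κ t x • grad u x) (G t)
      - ip Ω (fun x => f (val u x)) (quot ω ρ t))

/-- `(u, h)` is a weak solution of the inverse problem: `h ∈ L²(0,T)`, `u ∈ C([0,T]; H¹₀(Ω))`,
`∂ₜu = du ∈ L²((0,T); H¹₀(Ω))`, `u(0) = u₀`, and for almost every `t` the function `h` is given by
the explicit formula and the variational equation holds. Here `w = ∂ₜ(ρu)`, as a function with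
values in `L²(Ω)`. -/
def IsWeakSolution {d : ℕ} {Ω : Set (E d)} (T : ℝ) (ρ η κ : ℝ → LSp Ω ℝ ∞) (f : ℝ → ℝ)
    (p : ℝ → LSp Ω ℝ 2) (ω : H10 Ω) (dm : ℝ → ℝ) (G : ℝ → LSp Ω (E d) 2) (u₀ : H10 Ω)
    (u : ℝ → H10 Ω) (h : ℝ → ℝ) : Prop :=
  MemL2Time T h ∧ ContinuousOn u (Icc 0 T) ∧ u 0 = u₀ ∧
  ∃ (du : ℝ → H10 Ω) (w : ℝ → LSp Ω ℝ 2),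
    MemL2Time T du ∧ IsWeakTimeDeriv T u du ∧
    IsWeakTimeDeriv T (fun t => (ρ t • val (u t) : LSp Ω ℝ 2)) w ∧
    ∀ᵐ t ∂(volume.restrict (Ioo 0 T)),
      h t = sourceFormula T ρ η κ f p ω dm G t (u t) (du t) ∧
      ∀ φ : H10 Ω,
        ip Ω (w t) (val φ)
          + ip Ω (fun x => η t x • grad (du t) x) (grad φ)
          + ip Ω (fun x => κ t x • grad (u t) x) (grad φ)
        = h t * ip Ω (p t) (val φ) + ip Ω (fun x => f (val (u t) x)) (val φ)

end PseudoParabolic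

end

/-! Let `U`, `V`, `z` be the differences of the two solutions, of their time derivatives and of
their sources. Subtracting the source formulas cancels `m'`, so `z` depends only on `U` and `V`.
Testing the subtracted equation with `V` bounds `ρ₀‖V‖² + η₀‖∇V‖²`. Every term on the right carries
a factor `‖U‖`, except the part of `z` coming from `(η∇V, ∇(ω/ρ))`, which contributes at most `(P M
η₁ / ωm) ‖V‖ ‖∇V‖`. The smallness condition is what lets Young's inequality absorb this term, with a
factor `√ζ < 1`. Hence `‖V(t)‖ ≤ C ‖U(t)‖` in `H¹₀` for almost every `t` (`energy_inequality`,
`le_mul_of_quadratic_le`).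

Since `U(0) = 0`, Gronwall gives `U = 0`; the same estimate then gives `V = 0` almost everywhere,
and the source formula gives equality of the sources.

Time derivatives are distributional on the open interval, so two facts have to be supplied: the
fundamental theorem of calculus up to the end points (`IsWeakTimeDeriv.integral_eq_sub_zero`),
needed for Gronwall, and the product rule for `∂ₜ(ρu)` (`ae_eq_of_isWeakTimeDeriv_smul`), needed to
make `ρV` visible in the equation. -/

namespace PseudoParabolic

/-! ### Gronwall's lemma and weak time derivatives of continuous curves. -/

section TimeDerivative

open Filter Topology Real

theorem deriv_smoothTransition_of_nonpos {x : ℝ} (hx : x ≤ 0) : deriv smoothTransition x = 0 := by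
  have h : IsLocalMin smoothTransition x := by
    refine Filter.Eventually.of_forall fun y => ?_
    simpa [smoothTransition.zero_of_nonpos hx] using smoothTransition.nonneg y
  exact h.deriv_eq_zero

theorem deriv_smoothTransition_of_one_le {x : ℝ} (hx : 1 ≤ x) : deriv smoothTransition x = 0 := by
  have h : IsLocalMax smoothTransition x := by
    refine Filter.Eventually.of_forall fun y => ?_
    simpa [smoothTransition.one_of_one_le hx] using smoothTransition.le_one y
  exact h.deriv_eq_zero

theorem continuous_deriv_smoothTransition : Continuous (deriv smoothTransition) :=
  (smoothTransition.contDiff (n := 1)).continuous_deriv le_rfl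

theorem hasDerivAt_smoothTransition_sub_div (a ε τ : ℝ) :
    HasDerivAt (fun s => smoothTransition ((s - a) / ε))
      (ε⁻¹ * deriv smoothTransition ((τ - a) / ε)) τ := by
  have h1 : HasDerivAt smoothTransition (deriv smoothTransition ((τ - a) / ε)) ((τ - a) / ε) :=
    ((smoothTransition.contDiff (n := 1)).differentiable (by simp)).differentiableAt.hasDerivAt
  have h2 : HasDerivAt (fun s : ℝ => (s - a) / ε) (1 / ε) τ :=
    ((hasDerivAt_id τ).sub_const a).div_const ε
  have := h1.comp τ h2
  rw [one_div, mul_comm] at this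
  exact this

/-- Gronwall in integral form: the primitive of `‖v‖` starts at zero and its derivative is at most
`C` times itself, so it vanishes. No differentiability of `v` is required. -/
theorem eq_zero_of_norm_le_integral_norm {T C : ℝ} (hT : 0 < T) {Y : Type*} [NormedAddCommGroup Y] {v : ℝ → Y}
    (hv : ContinuousOn v (Icc 0 T))
    (h : ∀ t ∈ Icc 0 T, ‖v t‖ ≤ C * ∫ s in (0 : ℝ)..t, ‖v s‖) :
    ∀ t ∈ Icc 0 T, v t = 0 := by
  have hII : IntervalIntegrable (fun s => ‖v s‖) volume 0 T :=
    ContinuousOn.intervalIntegrable (by rw [uIcc_of_le hT.le]; exact hv.norm)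
  have hcont : ContinuousOn (fun t => ∫ s in (0 : ℝ)..t, ‖v s‖) (Icc 0 T) := by
    have := intervalIntegral.continuousOn_primitive_interval' hII left_mem_uIcc
    rwa [uIcc_of_le hT.le] at this
  have hz := eq_zero_of_abs_deriv_le_mul_abs_self_of_eq_zero_right (K := C)
    (f' := fun t => ‖v t‖) hcont ?_ (by simp) ?_
  · intro t ht
    have := h t ht
    rw [hz t ht, mul_zero] at this
    exact norm_le_zero_iff.1 this
  · intro t ht
    have hsub : Icc t T ⊆ Icc 0 T := Icc_subset_Icc_left ht.1
    have hmem : Icc 0 T ∈ 𝓝[>] t :=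
      mem_of_superset (Ioc_mem_nhdsGT ht.2) (Ioc_subset_Icc_self.trans hsub)
    have hmem' : Icc 0 T ∈ 𝓝[≥] t :=
      mem_of_superset (Icc_mem_nhdsGE ht.2) hsub
    refine intervalIntegral.integral_hasDerivWithinAt_right (s := Ici t) (t := Ioi t) ?_ ?_ ?_
    · refine hII.mono_set ?_
      rw [uIcc_of_le hT.le, uIcc_of_le ht.1]
      exact Icc_subset_Icc_right ht.2.le
    · exact ⟨Icc 0 T, hmem, hv.norm.aestronglyMeasurable measurableSet_Icc⟩
    · exact ((hv.norm t ⟨ht.1, ht.2.le⟩).mono_of_mem_nhdsWithin hmem)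
  · intro t ht
    have h1 := h t ⟨ht.1, ht.2.le⟩
    rw [norm_norm, Real.norm_of_nonneg
      (intervalIntegral.integral_nonneg ht.1 fun _ _ => norm_nonneg _)]
    exact h1

variable {X : Type} [NormedAddCommGroup X] [NormedSpace ℝ X] [CompleteSpace X]

/-- The derivatives of smoothed steps at `a` form an approximate identity at `a`. -/
theorem tendsto_setIntegral_deriv_step {T a : ℝ} {v : ℝ → X} (hv : ContinuousOn v (Icc 0 T))
    (ha : a ∈ Ioo 0 T) :
    Tendsto (fun ε : ℝ => ∫ τ in Ioo 0 T, (ε⁻¹ * deriv smoothTransition ((τ - a) / ε)) • v τ)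
      (𝓝[>] 0) (𝓝 (v a)) := by
  have hsmall : ∀ᶠ ε : ℝ in 𝓝[>] 0, 0 < ε ∧ a + ε < T := by
    filter_upwards [Ioo_mem_nhdsGT (show (0 : ℝ) < T - a by linarith [ha.2])] with ε hε
    exact ⟨hε.1, by linarith [hε.2]⟩
  -- The substitution `τ = ε x + a` fixes the kernel and moves `ε` into the argument of `v`, where
  -- continuity and dominated convergence apply.
  have hrew : ∀ᶠ ε : ℝ in 𝓝[>] 0,
      ∫ x in (0 : ℝ)..1, deriv smoothTransition x • v (ε * x + a)
        = ∫ τ in Ioo 0 T, (ε⁻¹ * deriv smoothTransition ((τ - a) / ε)) • v τ := by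
    filter_upwards [hsmall] with ε ⟨hε, hεT⟩
    have h1 : ∫ τ in Ioo 0 T, (ε⁻¹ * deriv smoothTransition ((τ - a) / ε)) • v τ
        = ∫ τ in Ioc a (a + ε), (ε⁻¹ * deriv smoothTransition ((τ - a) / ε)) • v τ := by
      refine setIntegral_eq_of_subset_of_forall_sdiff_eq_zero measurableSet_Ioo
        (fun x hx => ⟨ha.1.trans hx.1, hx.2.trans_lt hεT⟩) fun x hx => ?_
      rcases le_or_gt x a with h | h
      · rw [deriv_smoothTransition_of_nonpos (div_nonpos_of_nonpos_of_nonneg (by linarith) hε.le)]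
        simp
      · have : a + ε < x := by
          by_contra hc
          exact hx.2 ⟨h, not_lt.1 hc⟩
        rw [deriv_smoothTransition_of_one_le ((one_le_div hε).2 (by linarith))]
        simp
    have h2 := intervalIntegral.smul_integral_comp_mul_add (a := 0) (b := 1)
      (fun τ => (ε⁻¹ * deriv smoothTransition ((τ - a) / ε)) • v τ) ε a
    rw [h1, ← intervalIntegral.integral_of_le (by linarith)]
    simp only [mul_zero, zero_add, mul_one] at h2
    rw [add_comm a ε, ← h2, ← intervalIntegral.integral_smul]
    refine intervalIntegral.integral_congr fun x _ => ?_
    have : (ε * x + a - a) / ε = x := by field_simp; ring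
    simp only [this, smul_smul, ← mul_assoc, mul_inv_cancel₀ hε.ne', one_mul]
  refine Tendsto.congr' hrew ?_
  obtain ⟨C, hC⟩ := isCompact_Icc.exists_bound_of_continuousOn hv
  have hint : ∫ x in (0 : ℝ)..1, deriv smoothTransition x • v a = v a := by
    rw [intervalIntegral.integral_smul_const, intervalIntegral.integral_deriv_eq_sub]
    · simp
    · exact fun x _ => ((smoothTransition.contDiff (n := 1)).differentiable (by simp)).differentiableAt
    · exact continuous_deriv_smoothTransition.intervalIntegrable _ _
  conv => arg 3; rw [← hint]
  have hmem : ∀ ε : ℝ, 0 < ε → a + ε < T → ∀ x ∈ uIoc (0 : ℝ) 1, ε * x + a ∈ Icc 0 T := by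
    intro ε hε hεT x hx
    rw [uIoc_of_le zero_le_one] at hx
    have h1 : 0 ≤ ε * x := mul_nonneg hε.le hx.1.le
    have h2 : ε * x ≤ ε := by nlinarith [hx.2]
    exact ⟨by linarith [ha.1], by linarith⟩
  refine intervalIntegral.tendsto_integral_filter_of_dominated_convergence
    (fun x => ‖deriv smoothTransition x‖ * C) ?_ ?_ ?_ ?_
  · filter_upwards [hsmall] with ε ⟨hε, hεT⟩
    refine ContinuousOn.aestronglyMeasurable ?_ measurableSet_uIoc
    refine continuous_deriv_smoothTransition.continuousOn.smul (hv.comp (by fun_prop) ?_)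
    exact hmem ε hε hεT
  · filter_upwards [hsmall] with ε ⟨hε, hεT⟩
    refine Eventually.of_forall fun x hx => ?_
    rw [norm_smul]
    exact mul_le_mul_of_nonneg_left (hC _ (hmem ε hε hεT x hx)) (norm_nonneg _)
  · exact (continuous_deriv_smoothTransition.norm.mul continuous_const).intervalIntegrable _ _
  · refine Eventually.of_forall fun x hx => Tendsto.const_smul ?_ _
    have hva : ContinuousAt v a := hv.continuousAt (Icc_mem_nhds ha.1 ha.2)
    refine hva.tendsto.comp ?_
    have : Tendsto (fun ε : ℝ => ε * x + a) (𝓝 0) (𝓝 (0 * x + a)) :=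
      Continuous.tendsto (by fun_prop) 0
    simp only [zero_mul, zero_add] at this
    exact this.mono_left nhdsWithin_le_nhds

/-- The two steps cancel left of `a` and right of `b + ε`. As `ε → 0` these functions approximate
the indicator of `(a, b]`, so testing with them recovers the integral of the weak derivative over
`[a, b]`. -/
theorem isTestFunction_step_sub_step {T a b ε : ℝ} (ha : 0 < a) (hab : a ≤ b) (hε : 0 < ε)
    (hb : b + ε < T) :
    IsTestFunction (Ioo 0 T)
      (fun s => smoothTransition ((s - a) / ε) - smoothTransition ((s - b) / ε)) := by
  have hsupp : Function.support
      (fun s => smoothTransition ((s - a) / ε) - smoothTransition ((s - b) / ε))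
        ⊆ Icc a (b + ε) := by
    intro s hs
    by_contra hc
    rw [mem_Icc, not_and_or, not_le, not_le] at hc
    refine hs ?_
    rcases hc with h | h
    · simp only
      rw [smoothTransition.zero_of_nonpos (div_nonpos_of_nonpos_of_nonneg (by linarith) hε.le),
        smoothTransition.zero_of_nonpos (div_nonpos_of_nonpos_of_nonneg (by linarith) hε.le),
        sub_zero]
    · simp only
      rw [smoothTransition.one_of_one_le ((one_le_div hε).2 (by linarith)),
        smoothTransition.one_of_one_le ((one_le_div hε).2 (by linarith)), sub_self]
  refine ⟨?_, HasCompactSupport.of_support_subset_isCompact isCompact_Icc hsupp, ?_⟩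
  · exact (smoothTransition.contDiff.comp ((contDiff_id.sub contDiff_const).div_const _)).sub
      (smoothTransition.contDiff.comp ((contDiff_id.sub contDiff_const).div_const _))
  · exact (closure_minimal hsupp isClosed_Icc).trans
      fun s hs => ⟨ha.trans_le hs.1, hs.2.trans_lt hb⟩

theorem tendsto_smoothTransition_step (a s : ℝ) :
    Tendsto (fun ε : ℝ => smoothTransition ((s - a) / ε)) (𝓝[>] 0)
      (𝓝 ((Ioi a).indicator 1 s)) := by
  refine tendsto_const_nhds.congr' ?_
  rcases le_or_gt s a with h | h
  · filter_upwards [self_mem_nhdsWithin] with ε hε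
    rw [indicator_of_notMem (by simpa using h),
      smoothTransition.zero_of_nonpos (div_nonpos_of_nonpos_of_nonneg (by linarith) (le_of_lt hε))]
  · filter_upwards [Ioo_mem_nhdsGT (sub_pos.2 h)] with ε hε
    rw [indicator_of_mem (mem_Ioi.2 h), smoothTransition.one_of_one_le ((one_le_div hε.1).2 hε.2.le)]
    rfl

/-- The fundamental theorem of calculus for weak derivatives of continuous functions, away from
the end points. -/
theorem IsWeakTimeDeriv.integral_eq_sub {T : ℝ} {v dv : ℝ → X} (hv : ContinuousOn v (Icc 0 T))
    (hw : IsWeakTimeDeriv T v dv) {a b : ℝ} (ha : 0 < a) (hab : a ≤ b) (hb : b < T) :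
    ∫ s in a..b, dv s = v b - v a := by
  obtain ⟨-, hdv, hw⟩ := hw
  -- The weak derivative is only locally integrable; `[a, c]` is a fixed compact set containing the
  -- supports of all test functions with `b + ε < c`.
  obtain ⟨c, hbc, hcT⟩ := exists_between hb
  have hIcc : Icc a c ⊆ Ioo 0 T := fun s hs => ⟨ha.trans_le hs.1, hs.2.trans_lt hcT⟩
  have hdvI : IntegrableOn dv (Icc a c) :=
    hdv.integrableOn_compact_subset hIcc isCompact_Icc
  have hsmall : ∀ᶠ ε : ℝ in 𝓝[>] 0, 0 < ε ∧ b + ε < c := by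
    filter_upwards [Ioo_mem_nhdsGT (show (0 : ℝ) < c - b by linarith)] with ε hε
    exact ⟨hε.1, by linarith [hε.2]⟩
  set φ : ℝ → ℝ → ℝ := fun ε s => smoothTransition ((s - a) / ε) - smoothTransition ((s - b) / ε)
    with hφ
  have hφ_le : ∀ ε s, ‖φ ε s‖ ≤ 1 := fun ε s => by
    rw [Real.norm_eq_abs, abs_le]
    have h1 := smoothTransition.nonneg ((s - a) / ε)
    have h2 := smoothTransition.nonneg ((s - b) / ε)
    have h3 := smoothTransition.le_one ((s - a) / ε)
    have h4 := smoothTransition.le_one ((s - b) / ε)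
    constructor <;> simp only [hφ] <;> linarith
  have hφ_cont : ∀ ε, Continuous (φ ε) := fun ε => by
    have h : ∀ a : ℝ, Continuous fun s : ℝ => smoothTransition ((s - a) / ε) := fun a =>
      smoothTransition.continuous.comp ((continuous_id.sub continuous_const).div_const _)
    exact (h a).sub (h b)
  -- the left-hand side of the weak formulation
  have hL : Tendsto (fun ε => ∫ t in Ioo 0 T, deriv (φ ε) t • v t) (𝓝[>] 0) (𝓝 (v a - v b)) := by
    refine Tendsto.congr' ?_ ((tendsto_setIntegral_deriv_step hv ⟨ha, hab.trans_lt hb⟩).sub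
      (tendsto_setIntegral_deriv_step hv ⟨ha.trans_le hab, hb⟩))
    filter_upwards [hsmall] with ε hε
    have hi : ∀ a : ℝ, IntegrableOn
        (fun τ => (ε⁻¹ * deriv smoothTransition ((τ - a) / ε)) • v τ) (Ioo 0 T) := fun a => by
      refine IntegrableOn.mono_set (ContinuousOn.integrableOn_Icc ?_) Ioo_subset_Icc_self
      refine ContinuousOn.smul (Continuous.continuousOn ?_) hv
      exact continuous_const.mul (continuous_deriv_smoothTransition.comp
        ((continuous_id.sub continuous_const).div_const _))
    rw [← integral_sub (hi a) (hi b)]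
    refine integral_congr_ae (Eventually.of_forall fun t => ?_)
    have hd : deriv (φ ε) t = _ := ((hasDerivAt_smoothTransition_sub_div a ε t).sub
      (hasDerivAt_smoothTransition_sub_div b ε t)).deriv
    simp only [hd, sub_smul]
  -- the right-hand side of the weak formulation
  have hR : Tendsto (fun ε => ∫ t in Icc a c, φ ε t • dv t) (𝓝[>] 0)
      (𝓝 (∫ t in Icc a c, ((Ioi a).indicator 1 t - (Ioi b).indicator 1 t : ℝ) • dv t)) := by
    refine tendsto_integral_filter_of_dominated_convergence (fun t => ‖dv t‖) ?_ ?_ hdvI.norm ?_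
    · exact Eventually.of_forall fun ε =>
        (hφ_cont ε).aestronglyMeasurable.smul hdvI.aestronglyMeasurable
    · refine Eventually.of_forall fun ε => Eventually.of_forall fun t => ?_
      rw [norm_smul]
      exact mul_le_of_le_one_left (norm_nonneg _) (hφ_le ε t)
    · refine Eventually.of_forall fun t => Tendsto.smul_const ?_ _
      exact (tendsto_smoothTransition_step a t).sub (tendsto_smoothTransition_step b t)
  have hRval : ∫ t in Icc a c, ((Ioi a).indicator 1 t - (Ioi b).indicator 1 t : ℝ) • dv t
      = ∫ s in a..b, dv s := by
    rw [intervalIntegral.integral_of_le hab,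
      setIntegral_eq_of_subset_of_forall_sdiff_eq_zero (s := Ioc a b) measurableSet_Icc
        (fun x hx => ⟨hx.1.le, hx.2.trans hbc.le⟩)]
    · refine setIntegral_congr_fun measurableSet_Ioc fun t ht => ?_
      simp [ht.1, ht.2]
    · intro t ht
      by_cases h1 : a < t
      · have h2 : b < t := by
          by_contra hc
          exact ht.2 ⟨h1, not_lt.1 hc⟩
        simp [h1, h2]
      · have h2 : t ≤ b := (not_lt.1 h1).trans hab
        simp [not_lt.1 h1, h2]
  have hEq : ∀ᶠ ε in 𝓝[>] (0 : ℝ), -(∫ t in Icc a c, φ ε t • dv t)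
      = ∫ t in Ioo 0 T, deriv (φ ε) t • v t := by
    filter_upwards [hsmall] with ε hε
    rw [hw (φ ε) (isTestFunction_step_sub_step ha hab hε.1 (hε.2.trans hcT))]
    congr 1
    refine (setIntegral_eq_of_subset_of_forall_sdiff_eq_zero measurableSet_Ioo hIcc
      fun t ht => ?_).symm
    have ht' : t ∉ Icc a c := ht.2
    rw [mem_Icc, not_and_or, not_le, not_le] at ht'
    have hε0 := hε.1
    rcases ht' with h | h
    · simp only [hφ]
      rw [smoothTransition.zero_of_nonpos (div_nonpos_of_nonpos_of_nonneg (by linarith) hε0.le),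
        smoothTransition.zero_of_nonpos (div_nonpos_of_nonpos_of_nonneg (by linarith) hε0.le),
        sub_zero, zero_smul]
    · simp only [hφ]
      rw [smoothTransition.one_of_one_le ((one_le_div hε0).2 (by linarith)),
        smoothTransition.one_of_one_le ((one_le_div hε0).2 (by linarith)), sub_self, zero_smul]
  have := tendsto_nhds_unique (Tendsto.congr' hEq hR.neg) hL
  rw [hRval] at this
  rw [← neg_sub (v a), ← this, neg_neg]

/-- The fundamental theorem of calculus on `[0,T]` for continuous functions with an integrable weak
derivative. -/
theorem IsWeakTimeDeriv.integral_eq_sub_zero {T : ℝ} (hT : 0 < T) {v dv : ℝ → X}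
    (hv : ContinuousOn v (Icc 0 T)) (hw : IsWeakTimeDeriv T v dv)
    (hdv : IntegrableOn dv (Ioo 0 T)) {t : ℝ} (ht : t ∈ Icc 0 T) :
    ∫ s in (0 : ℝ)..t, dv s = v t - v 0 := by
  have hdv' : IntegrableOn dv (Icc 0 T) := by rwa [integrableOn_Icc_iff_integrableOn_Ioo]
  have hprim : ContinuousOn (fun t => ∫ s in (0 : ℝ)..t, dv s) (Icc 0 T) := by
    have := intervalIntegral.continuousOn_primitive_interval (a := (0 : ℝ)) (b := T) (μ := volume)
      (f := dv) (by rwa [uIcc_of_le hT.le])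
    rwa [uIcc_of_le hT.le] at this
  have hii : ∀ s ∈ Icc 0 T, ∀ r ∈ Icc 0 T, IntervalIntegrable dv volume s r := fun s hs r hr => by
    rw [intervalIntegrable_iff]
    exact hdv'.mono_set (uIoc_subset_uIcc.trans (uIcc_subset_Icc hs hr))
  obtain ⟨c, hc⟩ : (Ioo 0 T).Nonempty := nonempty_Ioo.2 hT
  have h0 : (0 : ℝ) ∈ Icc 0 T := ⟨le_rfl, hT.le⟩
  -- The curve minus its candidate primitive is constant on the open interval; both are continuous
  -- on `[0, T]`, so the constant persists at the end points.
  have hconst : EqOn (fun t => v t - ∫ s in (0 : ℝ)..t, dv s)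
      (fun _ => v c - ∫ s in (0 : ℝ)..c, dv s) (Icc 0 T) := by
    refine Set.EqOn.of_subset_closure (s := Ioo 0 T) (fun t ht => ?_) (hv.sub hprim)
      continuousOn_const Ioo_subset_Icc_self (by rw [closure_Ioo hT.ne])
    have hadd := intervalIntegral.integral_add_adjacent_intervals
      (hii 0 h0 c (Ioo_subset_Icc_self hc)) (hii c (Ioo_subset_Icc_self hc) t
        (Ioo_subset_Icc_self ht))
    have hct : ∫ s in c..t, dv s = v t - v c := by
      rcases le_total c t with h | h
      · exact hw.integral_eq_sub hv hc.1 h ht.2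
      · rw [intervalIntegral.integral_symm, hw.integral_eq_sub hv ht.1 h hc.2, neg_sub]
    rw [← hadd, hct]
    abel
  have e1 := hconst ht
  have e0 := hconst h0
  simp only [intervalIntegral.integral_same, sub_zero] at e1 e0
  rw [e0, ← e1]
  abel

/-- A continuous function is differentiable at almost every time, with its weak derivative as
derivative. -/
theorem IsWeakTimeDeriv.ae_hasDerivAt {T : ℝ} {v dv : ℝ → X} (hv : ContinuousOn v (Icc 0 T))
    (hw : IsWeakTimeDeriv T v dv) :
    ∀ᵐ t ∂(volume.restrict (Ioo 0 T)), HasDerivAt v (dv t) t := by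
  rw [ae_restrict_iff' measurableSet_Ioo, ae_iff]
  -- Local integrability suffices: near each time the curve is a constant plus a primitive of `dv`,
  -- and Lebesgue differentiation applies there.
  refine measure_null_of_locally_null _ fun t ht => ?_
  have ht0 : t ∈ Ioo 0 T := by
    by_contra h
    exact ht fun h' => absurd h' h
  obtain ⟨a, ha0, hat⟩ := exists_between ht0.1
  obtain ⟨b, htb, hbT⟩ := exists_between ht0.2
  have hab : a ≤ b := (hat.trans htb).le
  have hint : IntervalIntegrable dv volume a b := by
    rw [intervalIntegrable_iff_integrableOn_Icc_of_le hab]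
    exact hw.2.1.integrableOn_compact_subset
      (fun s hs => ⟨ha0.trans_le hs.1, hs.2.trans_lt hbT⟩) isCompact_Icc
  refine ⟨_, mem_nhdsWithin_of_mem_nhds (Ioo_mem_nhds hat htb) |> inter_mem self_mem_nhdsWithin, ?_⟩
  refine measure_mono_null ?_ (ae_iff.1 hint.ae_hasDerivAt_integral)
  rintro s ⟨hs, hsab⟩ hderiv
  refine hs fun _ => ?_
  rw [uIcc_of_le hab] at hderiv
  have hd := (hderiv (Ioo_subset_Icc_self hsab) a ⟨le_rfl, hab⟩).const_add (v a)
  refine hd.congr_of_eventuallyEq ?_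
  filter_upwards [Ioo_mem_nhds hsab.1 hsab.2] with r hr
  rw [hw.integral_eq_sub hv ha0 hr.1.le (hr.2.trans hbT)]
  abel

end TimeDerivative

end PseudoParabolic

namespace PseudoParabolic

/-! ### Multiplication of `L²` functions by `L^∞` coefficients. -/

section Multipliers

variable {α F : Type*} {mα : MeasurableSpace α} {μ : Measure α} [NormedAddCommGroup F]

theorem ae_norm_le_norm_Linfty (g : Lp F ∞ μ) : ∀ᵐ x ∂μ, ‖g x‖ ≤ ‖g‖ := by
  have hfin : eLpNormEssSup g μ ≠ ∞ := by
    rw [← eLpNorm_exponent_top]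
    exact Lp.eLpNorm_ne_top g
  filter_upwards [ae_le_eLpNormEssSup (f := g) (μ := μ)] with x hx
  rw [Lp.norm_def, eLpNorm_exponent_top, ← toReal_enorm]
  exact ENNReal.toReal_mono hfin hx

theorem norm_Linfty_smul_le_of_ae_le [NormedSpace ℝ F] {c : Lp ℝ ∞ μ} {C : ℝ}
    (hc : ∀ᵐ x ∂μ, |c x| ≤ C) (g : Lp F 2 μ) : ‖(c • g : Lp F 2 μ)‖ ≤ C * ‖g‖ := by
  refine Lp.norm_le_mul_norm_of_ae_le_mul ?_
  filter_upwards [hc, Lp.coeFn_lpSMul (r := 2) c g] with x hx hx'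
  rw [hx', Pi.smul_apply', norm_smul]
  exact mul_le_mul_of_nonneg_right hx (norm_nonneg _)

variable [InnerProductSpace ℝ F]

theorem mul_norm_sq_le_inner_Linfty_smul {c : Lp ℝ ∞ μ} {c₀ : ℝ}
    (hc : ∀ᵐ x ∂μ, c₀ ≤ c x) (g : Lp F 2 μ) : c₀ * ‖g‖ ^ 2 ≤ ⟪(c • g : Lp F 2 μ), g⟫_ℝ := by
  rw [← real_inner_self_eq_norm_sq, ← real_inner_smul_left, L2.inner_def, L2.inner_def]
  refine integral_mono_ae (L2.integrable_inner _ _) (L2.integrable_inner _ _) ?_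
  filter_upwards [hc, Lp.coeFn_lpSMul (r := 2) c g, Lp.coeFn_smul c₀ g] with x hx h1 h2
  simp only [h1, h2, Pi.smul_apply', Pi.smul_apply, real_inner_smul_left]
  exact mul_le_mul_of_nonneg_right hx real_inner_self_nonneg

end Multipliers

/-! ### Hilbert space form of the pairings, and the product rule for `ρ u`. -/

section InnerProducts

variable {d : ℕ} {Ω : Set (E d)}

theorem ip_eq_inner {F : Type} [NormedAddCommGroup F] [InnerProductSpace ℝ F] {v w : E d → F}
    {v' w' : LSp Ω F 2} (hv : v' =ᵐ[volume.restrict Ω] v) (hw : w' =ᵐ[volume.restrict Ω] w) :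
    ip Ω v w = ⟪v', w'⟫_ℝ := by
  rw [L2.inner_def, ip]
  refine integral_congr_ae ?_
  filter_upwards [hv, hw] with x h1 h2
  rw [h1, h2]

theorem ip_smul_eq_inner {F : Type} [NormedAddCommGroup F] [InnerProductSpace ℝ F]
    (c : LSp Ω ℝ ∞) (v w : LSp Ω F 2) :
    ip Ω (fun x => c x • v x) w = ⟪(c • v : LSp Ω F 2), w⟫_ℝ :=
  ip_eq_inner (Lp.coeFn_lpSMul c v) (ae_eq_refl _)

instance : CompleteSpace (H10 Ω) := by
  rw [H10]
  infer_instance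

theorem norm_val_le (v : H10 Ω) : ‖val v‖ ≤ ‖v‖ := by
  have h := WithLp.prod_norm_sq_eq_of_L2 (v : L2Pair Ω)
  refine le_of_sq_le_sq ?_ (norm_nonneg _)
  rw [val, ← Submodule.norm_coe, h]
  nlinarith [sq_nonneg ‖(v : L2Pair Ω).snd‖]

theorem norm_grad_le (v : H10 Ω) : ‖grad v‖ ≤ ‖v‖ := by
  have h := WithLp.prod_norm_sq_eq_of_L2 (v : L2Pair Ω)
  refine le_of_sq_le_sq ?_ (norm_nonneg _)
  rw [grad, ← Submodule.norm_coe, h]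
  nlinarith [sq_nonneg ‖(v : L2Pair Ω).fst‖]

theorem norm_sq_eq (v : H10 Ω) : ‖v‖ ^ 2 = ‖val v‖ ^ 2 + ‖grad v‖ ^ 2 :=
  WithLp.prod_norm_sq_eq_of_L2 (v : L2Pair Ω)

theorem val_sub (v w : H10 Ω) : val (v - w) = val v - val w := rfl

theorem grad_sub (v w : H10 Ω) : grad (v - w) = grad v - grad w := rfl

/-- The map `v ↦ v`, `H¹₀(Ω) → L²(Ω)`, as a continuous linear map. -/
noncomputable def valL (Ω : Set (E d)) : H10 Ω →L[ℝ] LSp Ω ℝ 2 :=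
  LinearMap.mkContinuous ⟨⟨val, fun _ _ => rfl⟩, fun _ _ => rfl⟩ 1
    (fun v => by rw [one_mul]; exact norm_val_le v)

/-- The product `L^∞(Ω) × L²(Ω) → L²(Ω)` as a continuous bilinear map. -/
noncomputable def mulL (Ω : Set (E d)) : LSp Ω ℝ ∞ →L[ℝ] LSp Ω ℝ 2 →L[ℝ] LSp Ω ℝ 2 :=
  (ContinuousLinearMap.mul ℝ ℝ).holderL (volume.restrict Ω) ∞ 2 2

theorem mulL_apply (c : LSp Ω ℝ ∞) (v : LSp Ω ℝ 2) :
    mulL Ω c v = (c • v : LSp Ω ℝ 2) := by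
  refine Lp.ext ?_
  filter_upwards [Lp.coeFn_lpSMul (r := 2) c v,
    (ContinuousLinearMap.mul ℝ ℝ).coeFn_holder (r := 2) c v] with x h1 h2
  rw [h1]
  exact h2

theorem Linfty_smul_sub {F : Type} [NormedAddCommGroup F] [NormedSpace ℝ F] (c : LSp Ω ℝ ∞)
    (v w : LSp Ω F 2) : (c • (v - w) : LSp Ω F 2) = c • v - c • w := by
  rw [sub_eq_add_neg, Lp.add_smul, Lp.smul_neg, sub_eq_add_neg]

/-- The weak derivative of `ρ u` is given by the product rule. -/
theorem ae_eq_of_isWeakTimeDeriv_smul {T : ℝ} {ρ : ℝ → LSp Ω ℝ ∞}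
    (hρ : ContDiffOn ℝ 1 ρ (Icc 0 T)) {u du : ℝ → H10 Ω} {w : ℝ → LSp Ω ℝ 2}
    (hu : ContinuousOn u (Icc 0 T)) (hdu : IsWeakTimeDeriv T u du)
    (hw : IsWeakTimeDeriv T (fun t => (ρ t • val (u t) : LSp Ω ℝ 2)) w) :
    ∀ᵐ t ∂(volume.restrict (Ioo 0 T)),
      w t = (timeDeriv T ρ t • val (u t) : LSp Ω ℝ 2) + (ρ t • val (du t) : LSp Ω ℝ 2) := by
  have hval : ContinuousOn (fun t => val (u t)) (Icc 0 T) := (valL Ω).continuous.comp_continuousOn hu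
  have hcont : ContinuousOn (fun t => (ρ t • val (u t) : LSp Ω ℝ 2)) (Icc 0 T) := by
    simp only [← mulL_apply]
    exact ((mulL Ω).continuous.comp_continuousOn hρ.continuousOn).clm_apply hval
  -- At almost every time both weak derivatives are classical ones, so the product rule for a
  -- bilinear map and uniqueness of derivatives identify `w t`.
  filter_upwards [hdu.ae_hasDerivAt hu, hw.ae_hasDerivAt hcont, ae_restrict_mem measurableSet_Ioo]
    with t h1 h2 ht
  have hnhds : Icc 0 T ∈ nhds t := Icc_mem_nhds ht.1 ht.2
  have hρt : HasDerivAt ρ (timeDeriv T ρ t) t :=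
    ((hρ.differentiableOn (by simp) t (Ioo_subset_Icc_self ht)).hasDerivWithinAt).hasDerivAt hnhds
  have hvt : HasDerivAt (fun t => val (u t)) (val (du t)) t :=
    (valL Ω).hasFDerivAt.comp_hasDerivAt t h1
  have h3 := ((mulL Ω).hasFDerivAt.comp_hasDerivAt t hρt).clm_apply hvt
  simp only [Function.comp_apply, mulL_apply] at h3
  exact h2.unique h3

end InnerProducts

/-! ### The curve `ω / ρ` and the superposition operator of `f`. -/

section Quotient

variable {d : ℕ} {Ω : Set (E d)}

/-- The functions `ω / ρ(t)` form a continuous curve in `L²(Ω)`. -/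
theorem exists_quot_continuousOn {T ρ₀ : ℝ} {ρ : ℝ → LSp Ω ℝ ∞} (hρ₀ : 0 < ρ₀)
    (hρ : ContinuousOn ρ (Icc 0 T))
    (hρ_bd : ∀ t ∈ Icc 0 T, ∀ᵐ x ∂(volume.restrict Ω), ρ₀ ≤ ρ t x) (ω : H10 Ω) :
    ∃ Q : ℝ → LSp Ω ℝ 2, ContinuousOn Q (Icc 0 T) ∧
      ∀ t ∈ Icc 0 T, Q t =ᵐ[volume.restrict Ω] quot ω ρ t ∧ ‖Q t‖ ≤ ρ₀⁻¹ * ‖val ω‖ := by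
  have hbd : ∀ t ∈ Icc 0 T, ∀ᵐ x ∂(volume.restrict Ω), ‖quot ω ρ t x‖ ≤ ρ₀⁻¹ * ‖val ω x‖ := by
    intro t ht
    filter_upwards [hρ_bd t ht] with x hx
    rw [quot, norm_div, div_eq_inv_mul, Real.norm_of_nonneg (hρ₀.le.trans hx)]
    gcongr
  have hmem : ∀ t ∈ Icc 0 T, MemLp (quot ω ρ t) 2 (volume.restrict Ω) := fun t ht =>
    (Lp.memLp (val ω)).of_le_mul
      ((Lp.aestronglyMeasurable _).aemeasurable.div
        (Lp.aestronglyMeasurable _).aemeasurable).aestronglyMeasurable (hbd t ht)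
  classical
  set Q : ℝ → LSp Ω ℝ 2 := fun t => if ht : t ∈ Icc 0 T then (hmem t ht).toLp else 0
  have hQ : ∀ t ∈ Icc 0 T, Q t =ᵐ[volume.restrict Ω] quot ω ρ t := fun t ht => by
    simp only [Q, dif_pos ht]
    exact MemLp.coeFn_toLp _
  -- Inversion is Lipschitz on `[ρ₀, ∞)` with constant `ρ₀⁻²`, so `ω / ρ` inherits continuity in
  -- time from `ρ`.
  have hdist : ∀ s ∈ Icc 0 T, ∀ t ∈ Icc 0 T,
      ‖Q s - Q t‖ ≤ (ρ₀⁻¹ * ρ₀⁻¹ * ‖ρ s - ρ t‖) * ‖val ω‖ := by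
    intro s hs t ht
    refine Lp.norm_le_mul_norm_of_ae_le_mul ?_
    filter_upwards [hQ s hs, hQ t ht, hρ_bd s hs, hρ_bd t ht, Lp.coeFn_sub (Q s) (Q t),
      Lp.coeFn_sub (ρ s) (ρ t), ae_norm_le_norm_Linfty (ρ s - ρ t)] with x h1 h2 h3 h4 h5 h6 h7
    rw [h5, Pi.sub_apply, h1, h2, quot, quot]
    rw [h6, Pi.sub_apply] at h7
    have hs0 := hρ₀.trans_le h3
    have ht0 := hρ₀.trans_le h4
    have : val ω x / ρ s x - val ω x / ρ t x
        = (ρ s x)⁻¹ * (ρ t x)⁻¹ * -(ρ s x - ρ t x) * val ω x := by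
      field_simp
      ring
    rw [this, norm_mul, norm_mul, norm_mul, norm_neg, norm_inv, norm_inv, Real.norm_of_nonneg hs0.le,
      Real.norm_of_nonneg ht0.le]
    gcongr
  refine ⟨Q, fun t ht => ?_, fun t ht => ⟨hQ t ht, ?_⟩⟩
  · rw [ContinuousWithinAt, tendsto_iff_norm_sub_tendsto_zero]
    have hlim := tendsto_iff_norm_sub_tendsto_zero.1 (hρ t ht)
    have hlim' := (hlim.const_mul (ρ₀⁻¹ * ρ₀⁻¹)).mul_const ‖val ω‖
    rw [mul_zero, zero_mul] at hlim'
    refine squeeze_zero' (Filter.Eventually.of_forall fun _ => norm_nonneg _) ?_ hlim'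
    filter_upwards [self_mem_nhdsWithin] with s hs
    exact hdist s hs t ht
  · refine Lp.norm_le_mul_norm_of_ae_le_mul ?_
    filter_upwards [hQ t ht, hbd t ht] with x h1 h2
    rwa [h1]

/-- A Lipschitz function acts on `L²(Ω)` if `Ω` is bounded. -/
theorem exists_superposition (hΩ : Bornology.IsBounded Ω) {f : ℝ → ℝ} {L : ℝ≥0}
    (hf : LipschitzWith L f) : ∃ N : LSp Ω ℝ 2 → LSp Ω ℝ 2,
      (∀ v, N v =ᵐ[volume.restrict Ω] fun x => f (v x)) ∧
        ∀ v w, ‖N v - N w‖ ≤ L * ‖v - w‖ := by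
  have hfin : IsFiniteMeasure (volume.restrict Ω) :=
    isFiniteMeasure_restrict.2 hΩ.measure_lt_top.ne
  have hmem : ∀ v : LSp Ω ℝ 2, MemLp (fun x => f (v x)) 2 (volume.restrict Ω) := fun v => by
    -- Only `f (v x) - f 0` is dominated by `v`; the constant `f 0` is square integrable because `Ω`
    -- has finite measure.
    have h1 : MemLp (fun x => f (v x) - f 0) 2 (volume.restrict Ω) := by
      refine (Lp.memLp v).of_le_mul (c := L) ?_ (Filter.Eventually.of_forall fun x => ?_)
      · exact (hf.continuous.comp_aestronglyMeasurable (Lp.aestronglyMeasurable v)).sub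
          aestronglyMeasurable_const
      · simpa using hf.norm_sub_le (v x) 0
    refine (h1.add (memLp_const (f 0))).ae_eq (Filter.Eventually.of_forall fun x => ?_)
    simp
  have hN : ∀ v, (hmem v).toLp =ᵐ[volume.restrict Ω] fun x => f (v x) :=
    fun v => MemLp.coeFn_toLp _
  refine ⟨fun v => (hmem v).toLp, hN, fun v w => Lp.norm_le_mul_norm_of_ae_le_mul ?_⟩
  filter_upwards [hN v, hN w, Lp.coeFn_sub (hmem v).toLp (hmem w).toLp, Lp.coeFn_sub v w]
    with x h1 h2 h3 h4
  rw [h3, h4, Pi.sub_apply, Pi.sub_apply, h1, h2]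
  exact hf.norm_sub_le _ _

end Quotient

/-! ### Absorption and the energy estimate at a fixed time. -/

section EnergyEstimate

/-- Absorption: the bound on `σ` makes `σAB` at most the fraction `√ζ` of the left side, by Young's
inequality. What remains is coercive in `D` and at most linear in `D` on the right, so one factor
`D` can be divided out. In the application `A`, `B`, `D` are the norms of `V`, of `∇V` and of `V` in
`H¹₀`. -/
theorem le_mul_of_quadratic_le {ρ₀ η₀ σ ζ c A B N D : ℝ} (hρ₀ : 0 < ρ₀) (hη₀ : 0 < η₀)
    (hζ₀ : 0 < ζ) (hζ₁ : ζ < 1) (hσ : σ ^ 2 ≤ 4 * ζ * (η₀ * ρ₀))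
    (hcN : 0 ≤ c * N) (hD₀ : 0 ≤ D) (hD : D ^ 2 = A ^ 2 + B ^ 2)
    (h : ρ₀ * A ^ 2 + η₀ * B ^ 2 ≤ σ * A * B + c * N * (A + B)) :
    D ≤ 2 * c / ((1 - √ζ) * min ρ₀ η₀) * N := by
  have hz : √ζ < 1 := by rw [Real.sqrt_lt' one_pos]; simpa using hζ₁
  have hmin : 0 < min ρ₀ η₀ := lt_min hρ₀ hη₀
  have hδ : 0 < (1 - √ζ) * min ρ₀ η₀ := mul_pos (by linarith) hmin
  have hσAB : σ * A * B ≤ √ζ * (ρ₀ * A ^ 2 + η₀ * B ^ 2) := by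
    refine le_of_sq_le_sq ?_ (by positivity)
    have h1 : (σ * A * B) ^ 2 ≤ 4 * ζ * (η₀ * ρ₀) * (A * B) ^ 2 := by
      rw [mul_assoc, mul_pow]
      exact mul_le_mul_of_nonneg_right hσ (sq_nonneg _)
    -- This is `4xy ≤ (x + y)²` with `x = ρ₀A²` and `y = η₀B²`.
    have h2 : 4 * ζ * (η₀ * ρ₀) * (A * B) ^ 2 ≤ ζ * (ρ₀ * A ^ 2 + η₀ * B ^ 2) ^ 2 := by
      nlinarith [mul_nonneg hζ₀.le (sq_nonneg (ρ₀ * A ^ 2 - η₀ * B ^ 2))]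
    rw [mul_pow √ζ, Real.sq_sqrt hζ₀.le]
    exact h1.trans h2
  have hAD : A ≤ D := le_of_sq_le_sq (by nlinarith [sq_nonneg B]) hD₀
  have hBD : B ≤ D := le_of_sq_le_sq (by nlinarith [sq_nonneg A]) hD₀
  have hlow : (1 - √ζ) * min ρ₀ η₀ * D ^ 2 ≤ 2 * (c * N) * D := by
    have h1 : min ρ₀ η₀ * D ^ 2 ≤ ρ₀ * A ^ 2 + η₀ * B ^ 2 := by
      rw [hD]
      nlinarith [mul_le_mul_of_nonneg_right (min_le_left ρ₀ η₀) (sq_nonneg A),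
        mul_le_mul_of_nonneg_right (min_le_right ρ₀ η₀) (sq_nonneg B)]
    have h2 : c * N * (A + B) ≤ c * N * (2 * D) := mul_le_mul_of_nonneg_left (by linarith) hcN
    nlinarith [mul_le_mul_of_nonneg_left h1 (by linarith : 0 ≤ 1 - √ζ)]
  rw [div_mul_eq_mul_div, le_div_iff₀ hδ]
  rcases hD₀.eq_or_lt with h0 | h0
  · rw [← h0]
    nlinarith
  · refine le_of_mul_le_mul_right ?_ h0
    nlinarith

variable {d : ℕ} {Ω : Set (E d)}

theorem abs_inner_le_of_norm_le {H : Type*} [NormedAddCommGroup H] [InnerProductSpace ℝ H]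
    {x y : H} {a b : ℝ} (hx : ‖x‖ ≤ a) (hy : ‖y‖ ≤ b) : |⟪x, y⟫_ℝ| ≤ a * b :=
  (abs_real_inner_le_norm x y).trans
    (mul_le_mul hx hy (norm_nonneg _) ((norm_nonneg _).trans hx))

/-- The energy inequality at a fixed time, tested with `∂ₜU = V`, for the difference `U` of two
solutions; `z` is the difference of the sources and `F` that of the nonlinear terms. -/
theorem energy_inequality {ρ₀ ρ' η₀ η₁ κ₁ L P M W q₁ b z : ℝ} {r r' e k : LSp Ω ℝ ∞}
    {p q F w : LSp Ω ℝ 2} {g : LSp Ω (E d) 2} {U V : H10 Ω}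
    (hρ' : 0 ≤ ρ') (hκ₁ : 0 ≤ κ₁) (hL : 0 ≤ L) (hW : 0 < W)
    (hr : ∀ᵐ x ∂(volume.restrict Ω), ρ₀ ≤ r x) (hr' : ∀ᵐ x ∂(volume.restrict Ω), |r' x| ≤ ρ')
    (he : ∀ᵐ x ∂(volume.restrict Ω), η₀ ≤ e x) (he' : ∀ᵐ x ∂(volume.restrict Ω), |e x| ≤ η₁)
    (hk : ∀ᵐ x ∂(volume.restrict Ω), |k x| ≤ κ₁)
    (hp : ‖p‖ ≤ P) (hg : ‖g‖ ≤ M) (hq : ‖q‖ ≤ q₁) (hb : W ≤ |b|) (hF : ‖F‖ ≤ L * ‖val U‖)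
    (hw : w = (r' • val U : LSp Ω ℝ 2) + (r • val V : LSp Ω ℝ 2))
    (hz : z = 1 / b * (⟪val U, (r' • q : LSp Ω ℝ 2)⟫_ℝ + ⟪(e • grad V : LSp Ω (E d) 2), g⟫_ℝ
      + ⟪(k • grad U : LSp Ω (E d) 2), g⟫_ℝ - ⟪F, q⟫_ℝ))
    (heq : ⟪w, val V⟫_ℝ + ⟪(e • grad V : LSp Ω (E d) 2), grad V⟫_ℝ
      + ⟪(k • grad U : LSp Ω (E d) 2), grad V⟫_ℝ = z * ⟪p, val V⟫_ℝ + ⟪F, val V⟫_ℝ) :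
    ρ₀ * ‖val V‖ ^ 2 + η₀ * ‖grad V‖ ^ 2 ≤ (P * M * η₁ / W) * ‖val V‖ * ‖grad V‖
      + (ρ' + κ₁ + L + P / W * (ρ' * q₁ + κ₁ * M + L * q₁)) * ‖U‖ * (‖val V‖ + ‖grad V‖) := by
  have hA := norm_nonneg (val V)
  have hB := norm_nonneg (grad V)
  have hN := norm_nonneg U
  have hP : 0 ≤ P := (norm_nonneg _).trans hp
  have hM : 0 ≤ M := (norm_nonneg _).trans hg
  have hq₁ : 0 ≤ q₁ := (norm_nonneg _).trans hq
  have hUv := norm_val_le U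
  have hUg := norm_grad_le U
  have hrU : ‖(r' • val U : LSp Ω ℝ 2)‖ ≤ ρ' * ‖U‖ :=
    (norm_Linfty_smul_le_of_ae_le hr' _).trans (by gcongr)
  have hrq : ‖(r' • q : LSp Ω ℝ 2)‖ ≤ ρ' * q₁ :=
    (norm_Linfty_smul_le_of_ae_le hr' _).trans (by gcongr)
  have heV : ‖(e • grad V : LSp Ω (E d) 2)‖ ≤ η₁ * ‖grad V‖ := norm_Linfty_smul_le_of_ae_le he' _
  have hkU : ‖(k • grad U : LSp Ω (E d) 2)‖ ≤ κ₁ * ‖U‖ :=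
    (norm_Linfty_smul_le_of_ae_le hk _).trans (by gcongr)
  have hFU : ‖F‖ ≤ L * ‖U‖ := hF.trans (by gcongr)
  have c1 := mul_norm_sq_le_inner_Linfty_smul hr (val V)
  have c2 := mul_norm_sq_le_inner_Linfty_smul he (grad V)
  have i1 := abs_le.1 (abs_inner_le_of_norm_le hrU le_rfl : |⟪_, val V⟫_ℝ| ≤ _)
  have i2 := abs_le.1 (abs_inner_le_of_norm_le hkU le_rfl : |⟪_, grad V⟫_ℝ| ≤ _)
  have i3 := abs_le.1 (abs_inner_le_of_norm_le hFU le_rfl : |⟪_, val V⟫_ℝ| ≤ _)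
  have i4 : |⟪p, val V⟫_ℝ| ≤ P * ‖val V‖ := abs_inner_le_of_norm_le hp le_rfl
  have hzle : |z| ≤ 1 / W * (‖U‖ * (ρ' * q₁) + η₁ * ‖grad V‖ * M + κ₁ * ‖U‖ * M
      + L * ‖U‖ * q₁) := by
    rw [hz, abs_mul, abs_div, abs_one]
    gcongr
    have j1 := abs_le.1 (abs_inner_le_of_norm_le hUv hrq)
    have j2 := abs_le.1 (abs_inner_le_of_norm_le heV hg)
    have j3 := abs_le.1 (abs_inner_le_of_norm_le hkU hg)
    have j4 := abs_le.1 (abs_inner_le_of_norm_le hFU hq)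
    rw [abs_le]
    constructor <;> linarith [j1.1, j1.2, j2.1, j2.2, j3.1, j3.2, j4.1, j4.2]
  have i5 : z * ⟪p, val V⟫_ℝ ≤ 1 / W * (‖U‖ * (ρ' * q₁) + η₁ * ‖grad V‖ * M + κ₁ * ‖U‖ * M
      + L * ‖U‖ * q₁) * (P * ‖val V‖) := by
    refine (le_abs_self _).trans ?_
    rw [abs_mul]
    exact mul_le_mul hzle i4 (abs_nonneg _) ((abs_nonneg _).trans hzle)
  -- Separates the one contribution quadratic in `V`, to be absorbed later, from those carrying a
  -- factor `‖U‖`.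
  have i6 : 1 / W * (‖U‖ * (ρ' * q₁) + η₁ * ‖grad V‖ * M + κ₁ * ‖U‖ * M + L * ‖U‖ * q₁)
      * (P * ‖val V‖) = (P * M * η₁ / W) * ‖val V‖ * ‖grad V‖
        + P / W * (ρ' * q₁ + κ₁ * M + L * q₁) * ‖U‖ * ‖val V‖ := by
    ring
  rw [hw, inner_add_left] at heq
  -- These nonnegative terms complete the sharper bounds to the common factor `‖val V‖ + ‖grad V‖`.
  have n1 : 0 ≤ P / W * (ρ' * q₁ + κ₁ * M + L * q₁) * ‖U‖ * ‖grad V‖ := by positivity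
  have n2 : 0 ≤ (ρ' + L) * ‖U‖ * ‖grad V‖ := by positivity
  have n3 : 0 ≤ κ₁ * ‖U‖ * ‖val V‖ := by positivity
  linarith [i1.1, i2.1, i3.2]

end EnergyEstimate

end PseudoParabolic

/-! ### Comparison of two solutions. -/

namespace PseudoParabolic

variable {d : ℕ} {Ω : Set (E d)}

/-- Reading `ω ∂ₜρ / ρ` as `∂ₜρ` times `q = ω / ρ` turns every integral into an inner product in
`L²`, so that differences of sources follow by linearity. -/
theorem sourceFormula_eq_inner {T : ℝ} {ρ η κ : ℝ → LSp Ω ℝ ∞} {f : ℝ → ℝ}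
    {p : ℝ → LSp Ω ℝ 2} {ω : H10 Ω} {dm : ℝ → ℝ} {G : ℝ → LSp Ω (E d) 2} {t : ℝ} {u du : H10 Ω}
    {q F : LSp Ω ℝ 2} (hq : q =ᵐ[volume.restrict Ω] quot ω ρ t)
    (hF : F =ᵐ[volume.restrict Ω] fun x => f (val u x)) :
    sourceFormula T ρ η κ f p ω dm G t u du = 1 / omegaBar p ω ρ t *
      (dm t + ⟪val u, (timeDeriv T ρ t • q : LSp Ω ℝ 2)⟫_ℝ
        + ⟪(η t • grad du : LSp Ω (E d) 2), G t⟫_ℝ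
        + ⟪(κ t • grad u : LSp Ω (E d) 2), G t⟫_ℝ - ⟪F, q⟫_ℝ) := by
  have hmul : (timeDeriv T ρ t • q : LSp Ω ℝ 2) =ᵐ[volume.restrict Ω]
      fun x => val ω x * timeDeriv T ρ t x / ρ t x := by
    filter_upwards [hq, Lp.coeFn_lpSMul (r := 2) (timeDeriv T ρ t) q] with x h1 h2
    rw [h2, Pi.smul_apply', h1, quot, smul_eq_mul]
    ring
  rw [sourceFormula, ip_eq_inner (ae_eq_refl _) hmul, ip_smul_eq_inner, ip_smul_eq_inner,
    ip_eq_inner hF hq]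

/-- The energy estimate for the difference of two solutions at a fixed time. -/
theorem norm_sub_le_of_equation {T : ℝ} {ρ η κ : ℝ → LSp Ω ℝ ∞} {f : ℝ → ℝ} {p : ℝ → LSp Ω ℝ 2}
    {ω : H10 Ω} {dm : ℝ → ℝ} {G : ℝ → LSp Ω (E d) 2} {t : ℝ}
    {ρ₀ ρ' η₀ η₁ κ₁ P M W q₁ ζ z₁ z₂ : ℝ} {L : ℝ≥0} {u₁ u₂ v₁ v₂ : H10 Ω} {q w₁ w₂ : LSp Ω ℝ 2}
    {N : LSp Ω ℝ 2 → LSp Ω ℝ 2}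
    (hN : ∀ v, N v =ᵐ[volume.restrict Ω] fun x => f (v x))
    (hN_lip : ∀ v w, ‖N v - N w‖ ≤ L * ‖v - w‖)
    (hρ₀ : 0 < ρ₀) (hη₀ : 0 < η₀) (hρ' : 0 ≤ ρ') (hκ₁ : 0 ≤ κ₁) (hW : 0 < W)
    (hζ₀ : 0 < ζ) (hζ₁ : ζ < 1) (hsmall : (P * M * η₁ / W) ^ 2 ≤ 4 * ζ * (η₀ * ρ₀))
    (hr : ∀ᵐ x ∂(volume.restrict Ω), ρ₀ ≤ ρ t x)
    (hr' : ∀ᵐ x ∂(volume.restrict Ω), |timeDeriv T ρ t x| ≤ ρ')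
    (he : ∀ᵐ x ∂(volume.restrict Ω), η₀ ≤ η t x)
    (he' : ∀ᵐ x ∂(volume.restrict Ω), |η t x| ≤ η₁)
    (hk : ∀ᵐ x ∂(volume.restrict Ω), |κ t x| ≤ κ₁)
    (hp : ‖p t‖ ≤ P) (hg : ‖G t‖ ≤ M) (hq : q =ᵐ[volume.restrict Ω] quot ω ρ t) (hq₁ : ‖q‖ ≤ q₁)
    (hb : W ≤ |omegaBar p ω ρ t|)
    (hw₁ : w₁ = (timeDeriv T ρ t • val u₁ : LSp Ω ℝ 2) + (ρ t • val v₁ : LSp Ω ℝ 2))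
    (hw₂ : w₂ = (timeDeriv T ρ t • val u₂ : LSp Ω ℝ 2) + (ρ t • val v₂ : LSp Ω ℝ 2))
    (hz₁ : z₁ = sourceFormula T ρ η κ f p ω dm G t u₁ v₁)
    (hz₂ : z₂ = sourceFormula T ρ η κ f p ω dm G t u₂ v₂)
    (heq₁ : ∀ φ : H10 Ω, ip Ω w₁ (val φ) + ip Ω (fun x => η t x • grad v₁ x) (grad φ)
      + ip Ω (fun x => κ t x • grad u₁ x) (grad φ)
        = z₁ * ip Ω (p t) (val φ) + ip Ω (fun x => f (val u₁ x)) (val φ))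
    (heq₂ : ∀ φ : H10 Ω, ip Ω w₂ (val φ) + ip Ω (fun x => η t x • grad v₂ x) (grad φ)
      + ip Ω (fun x => κ t x • grad u₂ x) (grad φ)
        = z₂ * ip Ω (p t) (val φ) + ip Ω (fun x => f (val u₂ x)) (val φ)) :
    ‖v₁ - v₂‖ ≤ 2 * (ρ' + κ₁ + L + P / W * (ρ' * q₁ + κ₁ * M + L * q₁))
      / ((1 - √ζ) * min ρ₀ η₀) * ‖u₁ - u₂‖ := by
  have hP : 0 ≤ P := (norm_nonneg _).trans hp
  have hM : 0 ≤ M := (norm_nonneg _).trans hg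
  have hq0 : 0 ≤ q₁ := (norm_nonneg _).trans hq₁
  -- Both equations are tested with the difference of the time derivatives, an admissible function
  -- because these take values in `H¹₀`.
  have e₁ := heq₁ (v₁ - v₂)
  have e₂ := heq₂ (v₁ - v₂)
  rw [ip_eq_inner (ae_eq_refl _) (ae_eq_refl _), ip_smul_eq_inner, ip_smul_eq_inner,
    ip_eq_inner (hN (val u₁)) (ae_eq_refl _), ip_eq_inner (ae_eq_refl (p t)) (ae_eq_refl _)] at e₁
  rw [ip_eq_inner (ae_eq_refl _) (ae_eq_refl _), ip_smul_eq_inner, ip_smul_eq_inner,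
    ip_eq_inner (hN (val u₂)) (ae_eq_refl _), ip_eq_inner (ae_eq_refl (p t)) (ae_eq_refl _)] at e₂
  rw [sourceFormula_eq_inner hq (hN (val u₁))] at hz₁
  rw [sourceFormula_eq_inner hq (hN (val u₂))] at hz₂
  refine le_mul_of_quadratic_le hρ₀ hη₀ hζ₀ hζ₁ hsmall
    (by positivity) (norm_nonneg _) (norm_sq_eq _) ?_
  refine energy_inequality (b := omegaBar p ω ρ t) (z := z₁ - z₂) (q := q) (p := p t) (g := G t)
    (F := N (val u₁) - N (val u₂)) (w := w₁ - w₂)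
    hρ' hκ₁ L.coe_nonneg hW hr hr' he he' hk hp hg hq₁ hb ?_ ?_ ?_ ?_
  · rw [val_sub]
    exact hN_lip _ _
  · rw [hw₁, hw₂, val_sub, val_sub, Linfty_smul_sub, Linfty_smul_sub]
    abel
  · rw [hz₁, hz₂, val_sub, grad_sub, grad_sub, Linfty_smul_sub, Linfty_smul_sub]
    simp only [inner_sub_left]
    ring
  · rw [grad_sub u₁, grad_sub v₁, Linfty_smul_sub, Linfty_smul_sub, ← grad_sub v₁]
    simp only [inner_sub_left]
    linarith

/-- Two continuous curves with the same initial value whose weak derivatives differ by at most a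
multiple of the difference of the curves agree. -/
theorem eq_of_norm_weakTimeDeriv_sub_le {T C : ℝ} (hT : 0 < T) {X : Type} [NormedAddCommGroup X]
    [NormedSpace ℝ X] [CompleteSpace X] {u₁ u₂ v₁ v₂ : ℝ → X}
    (hu₁ : ContinuousOn u₁ (Icc 0 T)) (hu₂ : ContinuousOn u₂ (Icc 0 T)) (h0 : u₁ 0 = u₂ 0)
    (hv₁ : IntegrableOn v₁ (Ioo 0 T)) (hv₂ : IntegrableOn v₂ (Ioo 0 T))
    (hw₁ : IsWeakTimeDeriv T u₁ v₁) (hw₂ : IsWeakTimeDeriv T u₂ v₂)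
    (h : ∀ᵐ t ∂(volume.restrict (Ioo 0 T)), ‖v₁ t - v₂ t‖ ≤ C * ‖u₁ t - u₂ t‖) :
    ∀ t ∈ Icc 0 T, u₁ t = u₂ t := by
  have hcont := hu₁.sub hu₂
  have hII : ∀ v : ℝ → X, IntegrableOn v (Ioo 0 T) → ∀ t ∈ Icc 0 T,
      IntervalIntegrable v volume 0 t := fun v hv t ht => by
    rw [intervalIntegrable_iff_integrableOn_Ioo_of_le ht.1]
    exact hv.mono_set (Ioo_subset_Ioo_right ht.2)
  have hzero := eq_zero_of_norm_le_integral_norm (C := C) hT hcont fun t ht => by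
    have h1 : (u₁ - u₂) t = ∫ s in (0 : ℝ)..t, (v₁ s - v₂ s) := by
      rw [intervalIntegral.integral_sub (hII _ hv₁ t ht) (hII _ hv₂ t ht),
        hw₁.integral_eq_sub_zero hT hu₁ hv₁ ht, hw₂.integral_eq_sub_zero hT hu₂ hv₂ ht, h0,
        Pi.sub_apply]
      abel
    rw [h1, ← intervalIntegral.integral_const_mul]
    refine intervalIntegral.norm_integral_le_of_norm_le ht.1 ?_ ?_
    · rw [restrict_Ioo_eq_restrict_Ioc, ae_restrict_iff' measurableSet_Ioc] at h
      filter_upwards [h] with s hs hst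
      exact hs ⟨hst.1, hst.2.trans ht.2⟩
    · refine ContinuousOn.intervalIntegrable ?_
      rw [uIcc_of_le ht.1]
      exact (continuousOn_const.mul hcont.norm).mono (Icc_subset_Icc_right ht.2)
  exact fun t ht => sub_eq_zero.1 (hzero t ht)

end PseudoParabolic

/-! ### Uniqueness of the couple. -/

open PseudoParabolic in
theorem mainTheorem2 {d : ℕ} (hd : 0 < d)
    (Ω : Set (E d)) (hΩ_open : IsOpen Ω) (hΩ_bdd : Bornology.IsBounded Ω)
    (T : ℝ) (hT : 0 < T)
    (ρ : ℝ → LSp Ω ℝ ∞) (ρ₀ ρ₁ ρ₁' : ℝ)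
    (hρ_C1 : ContDiffOn ℝ 1 ρ (Set.Icc 0 T)) (hρ₀ : 0 < ρ₀)
    (hρ_bd : ∀ t ∈ Set.Icc 0 T, ∀ᵐ x ∂(volume.restrict Ω), ρ₀ ≤ ρ t x ∧ ρ t x ≤ ρ₁)
    (hρ'_bd : ∀ t ∈ Set.Icc 0 T, ∀ᵐ x ∂(volume.restrict Ω), |timeDeriv T ρ t x| ≤ ρ₁')
    (η : ℝ → LSp Ω ℝ ∞) (η₀ η₁ : ℝ)
    (hη_C : ContinuousOn η (Set.Icc 0 T)) (hη₀ : 0 < η₀)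
    (hη_bd : ∀ t ∈ Set.Icc 0 T, ∀ᵐ x ∂(volume.restrict Ω), η₀ ≤ η t x ∧ η t x ≤ η₁)
    (κ : ℝ → LSp Ω ℝ ∞) (κ₀ κ₁ κ₁' : ℝ)
    (hκ_C1 : ContDiffOn ℝ 1 κ (Set.Icc 0 T)) (hκ₀ : 0 < κ₀)
    (hκ_bd : ∀ t ∈ Set.Icc 0 T, ∀ᵐ x ∂(volume.restrict Ω), κ₀ ≤ κ t x ∧ κ t x ≤ κ₁)
    (hκ'_bd : ∀ t ∈ Set.Icc 0 T, ∀ᵐ x ∂(volume.restrict Ω), |timeDeriv T κ t x| ≤ κ₁')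
    (f : ℝ → ℝ) (L : ℝ≥0) (hf : LipschitzWith L f)
    (u₀ : H10 Ω)
    (hρ_H1 : ∃ R : ℝ → L2Pair Ω, ContinuousOn R (Set.Icc 0 T) ∧
      ∀ t ∈ Set.Icc 0 T, R t ∈ H1 Ω ∧ (R t).fst =ᵐ[volume.restrict Ω] ρ t)
    (ω : H10 Ω)
    (p : ℝ → LSp Ω ℝ 2) (hp : ContinuousOn p (Set.Icc 0 T))
    (hω_ne : ∀ t ∈ Set.Icc 0 T, omegaBar p ω ρ t ≠ 0)
    (m dm : ℝ → ℝ) (hm : MemL2Time T m) (hdm : MemL2Time T dm)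
    (hm_deriv : IsWeakTimeDeriv T m dm)
    (G : ℝ → LSp Ω (E d) 2)
    (hG : ∀ t ∈ Set.Icc 0 T, IsWeakGradient Ω (quot ω ρ t) (G t))
    (hG_bdd : BddAbove ((fun t => ‖G t‖) '' Set.Icc 0 T))
    (P M ωm : ℝ)
    (hP : P = sSup ((fun t => ‖p t‖) '' Set.Icc 0 T))
    (hM : M = sSup ((fun t => ‖G t‖) '' Set.Icc 0 T))
    (hωm : ωm = sInf ((fun t => |omegaBar p ω ρ t|) '' Set.Icc 0 T))
    (hsmall : ∃ ζ : ℝ, 0 < ζ ∧ ζ < 1 ∧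
      P ^ 2 * (M ^ 2 * η₁ ^ 2 / (4 * ωm ^ 2 * η₀ * ρ₀)) < ζ)
    (u₁ u₂ : ℝ → H10 Ω) (h₁ h₂ : ℝ → ℝ)
    (hsol₁ : IsWeakSolution T ρ η κ f p ω dm G u₀ u₁ h₁)
    (hsol₂ : IsWeakSolution T ρ η κ f p ω dm G u₀ u₂ h₂) :
    (∀ t ∈ Set.Icc 0 T, u₁ t = u₂ t) ∧
      h₁ =ᵐ[volume.restrict (Set.Ioo 0 T)] h₂ := by
  have h0T : (0 : ℝ) ∈ Set.Icc 0 T := ⟨le_rfl, hT.le⟩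
  obtain ⟨Q, hQ_cont, hQ⟩ := exists_quot_continuousOn hρ₀ hρ_C1.continuousOn
    (fun t ht => (hρ_bd t ht).mono fun _ hx => hx.1) ω
  obtain ⟨N, hN, hN_lip⟩ := exists_superposition hΩ_bdd hf
  obtain ⟨ζ, hζ₀, hζ₁, hζ⟩ := hsmall
  have hωb : ∀ t ∈ Set.Icc 0 T, omegaBar p ω ρ t = ⟪p t, Q t⟫_ℝ := fun t ht =>
    ip_eq_inner (ae_eq_refl _) (hQ t ht).1
  have hωb_cont : ContinuousOn (fun t => |omegaBar p ω ρ t|) (Set.Icc 0 T) :=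
    ((ContinuousOn.inner (𝕜 := ℝ) hp hQ_cont).congr hωb).abs
  -- The infimum is attained, by continuity on a compact interval, so pointwise nonvanishing
  -- suffices.
  have hW : 0 < ωm := by
    obtain ⟨t, ht, hmin⟩ := (isCompact_Icc.image_of_continuousOn hωb_cont).sInf_mem
      (Set.Nonempty.image _ ⟨0, h0T⟩)
    rw [hωm, ← hmin]
    exact abs_pos.2 (hω_ne t ht)
  have hb : ∀ t ∈ Set.Icc 0 T, ωm ≤ |omegaBar p ω ρ t| := fun t ht => by
    rw [hωm]
    exact csInf_le (isCompact_Icc.image_of_continuousOn hωb_cont).bddBelow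
      (Set.mem_image_of_mem _ ht)
  have hpP : ∀ t ∈ Set.Icc 0 T, ‖p t‖ ≤ P := fun t ht => by
    rw [hP]
    exact le_csSup (isCompact_Icc.image_of_continuousOn hp.norm).bddAbove
      (Set.mem_image_of_mem (fun t => ‖p t‖) ht)
  have hGM : ∀ t ∈ Set.Icc 0 T, ‖G t‖ ≤ M := fun t ht => by
    rw [hM]
    exact le_csSup hG_bdd (Set.mem_image_of_mem (fun t => ‖G t‖) ht)
  have hquad : (P * M * η₁ / ωm) ^ 2 ≤ 4 * ζ * (η₀ * ρ₀) := by
    have h4 : 0 < 4 * (η₀ * ρ₀) := by positivity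
    calc (P * M * η₁ / ωm) ^ 2
        = P ^ 2 * (M ^ 2 * η₁ ^ 2 / (4 * ωm ^ 2 * η₀ * ρ₀)) * (4 * (η₀ * ρ₀)) := by
          field_simp
      _ ≤ ζ * (4 * (η₀ * ρ₀)) := mul_le_mul_of_nonneg_right hζ.le h4.le
      _ = 4 * ζ * (η₀ * ρ₀) := by ring
  obtain ⟨-, hu₁, hu₁0, v₁, w₁, hv₁, hdu₁, hdw₁, hsol₁⟩ := hsol₁
  obtain ⟨-, hu₂, hu₂0, v₂, w₂, hv₂, hdu₂, hdw₂, hsol₂⟩ := hsol₂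
  -- The absolute values supply the signs of `ρ₁'` and `κ₁`, which are not assumed; `ρ₀⁻¹ * ‖val ω‖`
  -- bounds `‖Q t‖`.
  have hest : ∀ᵐ t ∂(volume.restrict (Set.Ioo 0 T)), ‖v₁ t - v₂ t‖ ≤
      2 * (|ρ₁'| + |κ₁| + L + P / ωm * (|ρ₁'| * (ρ₀⁻¹ * ‖val ω‖) + |κ₁| * M
        + L * (ρ₀⁻¹ * ‖val ω‖))) / ((1 - √ζ) * min ρ₀ η₀) * ‖u₁ t - u₂ t‖ := by
    filter_upwards [hsol₁, hsol₂, ae_eq_of_isWeakTimeDeriv_smul hρ_C1 hu₁ hdu₁ hdw₁,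
      ae_eq_of_isWeakTimeDeriv_smul hρ_C1 hu₂ hdu₂ hdw₂, ae_restrict_mem measurableSet_Ioo]
      with t hs₁ hs₂ hw₁ hw₂ ht
    have ht' := Set.Ioo_subset_Icc_self ht
    exact norm_sub_le_of_equation hN hN_lip hρ₀ hη₀ (abs_nonneg _) (abs_nonneg _) hW hζ₀ hζ₁ hquad
      ((hρ_bd t ht').mono fun _ hx => hx.1)
      ((hρ'_bd t ht').mono fun _ hx => hx.trans (le_abs_self _))
      ((hη_bd t ht').mono fun _ hx => hx.1)
      ((hη_bd t ht').mono fun _ hx => by rw [abs_of_nonneg (hη₀.le.trans hx.1)]; exact hx.2)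
      ((hκ_bd t ht').mono fun _ hx => by
        rw [abs_of_nonneg (hκ₀.le.trans hx.1)]; exact hx.2.trans (le_abs_self _))
      (hpP t ht') (hGM t ht') (hQ t ht').1 (hQ t ht').2 (hb t ht') hw₁ hw₂ hs₁.1 hs₂.1 hs₁.2 hs₂.2
  have hint : ∀ v : ℝ → H10 Ω, MemL2Time T v → IntegrableOn v (Set.Ioo 0 T) :=
    fun v hv => MemLp.integrable one_le_two hv
  have hu : ∀ t ∈ Set.Icc 0 T, u₁ t = u₂ t :=
    eq_of_norm_weakTimeDeriv_sub_le hT hu₁ hu₂ (hu₁0.trans hu₂0.symm) (hint _ hv₁) (hint _ hv₂)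
      hdu₁ hdu₂ hest
  refine ⟨hu, ?_⟩
  -- The source formula involves `∂ₜu`, so equality of the curves alone is not enough; the estimate
  -- with zero right side also identifies the derivatives.
  filter_upwards [hsol₁, hsol₂, hest, ae_restrict_mem measurableSet_Ioo] with t hs₁ hs₂ he ht
  have hut := hu t (Set.Ioo_subset_Icc_self ht)
  rw [hut, sub_self, norm_zero, mul_zero, norm_le_zero_iff, sub_eq_zero] at he
  rw [hs₁.1, hs₂.1, hut, he]
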